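/- Let $m\ge 1$, let $a_0,a_1,\dots,a_m\in\mathbb R$ with $a_0\neq 0$, and for $w\in\mathbb C$, $\ell\in\mathbb R^m$ put $Q(w,\ell)=a_0+\sum_{i=1}^m a_i e^{\ell_i w}$. Let $\mathcal S=\{\ell\in\mathbb R_{>0}^m : \ell_i<\ell_m \text{ for } 1\le i\le m-1\}$, and for $\ell\in\mathcal S$ let $\mathcal Z(\ell)=\{w\in\mathbb C : Q(w,\ell)=0\}$. For $p\in\mathcal S$ let $\Lambda(p)\subseteq\mathbb R$ be the set of limit points of $\mathrm{Re}\,\mathcal Z(q)$ as $q\to p$, that is, the set of all $w\in\mathbb R$ for which there are $q_k\in\mathcal S$ and $\omega_k\in\mathcal Z(q_k)$ $(k\in\mathbb N)$ with $q_k\to p$ and $\mathrm{Re}\,\omega_k\to w$. Then for every $p\in\mathcal S$: (1) $\Lambda(p)=\{w\in\mathbb R : \exists\,\xi_1,\dots,\xi_m\in S^1,\ a_0+\sum_{i=1}^m a_i\xi_i e^{p_i w}=0\}$, where $S^1=\{z\in\mathbb C: |z|=1\}$. (2) If moreover $a_m\ne 0$ and at least one of $a_1,\dots,a_{m-1}$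 is nonzero (in particular, if $m\ge 2$ and all $a_i$ are nonzero), then $\Lambda(p)$ is the union of an at most countable collection of pairwise disjoint closed intervals $[x,y]$ with $x<y$. -/

import Mathlib

open Filter Topology

namespace PolyExp

/-- The poly-exponential `Q(w, ℓ) = a₀ + ∑ᵢ aᵢ exp(ℓᵢ w)` with `m = n + 1` exponents; the exponents
`ℓ₁, …, ℓ_m` are indexed by `Fin (n + 1)`, so that `ℓ_m` is `ℓ (Fin.last n)`. -/
noncomputable def Q {n : ℕ} (a₀ : ℝ) (a : Fin (n + 1) → ℝ) (w : ℂ) (l : Fin (n + 1) → ℝ) : ℂ :=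
  (a₀ : ℂ) + ∑ i, (a i : ℂ) * Complex.exp ((l i : ℂ) * w)

/-- The parameter space `𝒮`: all exponents are positive, and the last one is strictly larger than
every other one. -/
def S (n : ℕ) : Set (Fin (n + 1) → ℝ) :=
  {l | (∀ i, 0 < l i) ∧ ∀ i, i ≠ Fin.last n → l i < l (Fin.last n)}

/-- The spectrum `𝒵(ℓ)`: the set of complex zeros of `Q(·, ℓ)`. -/
def spectrum {n : ℕ} (a₀ : ℝ) (a : Fin (n + 1) → ℝ) (l : Fin (n + 1) → ℝ) : Set ℂ :=
  {w | Q a₀ a w l = 0}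

/-- `Λ(p)`: the limit points of `Re 𝒵(q)` as `q → p` in `𝒮`, that is, the real numbers that are
limits of `Re (ω k)` with `ω k ∈ 𝒵(q k)`, `q k ∈ 𝒮` and `q k → p`. -/
def Lam {n : ℕ} (a₀ : ℝ) (a : Fin (n + 1) → ℝ) (p : Fin (n + 1) → ℝ) : Set ℝ :=
  {w | ∃ (q : ℕ → Fin (n + 1) → ℝ) (ω : ℕ → ℂ),
    (∀ k, q k ∈ S n) ∧ (∀ k, ω k ∈ spectrum a₀ a (q k)) ∧
    Tendsto q atTop (𝓝 p) ∧ Tendsto (fun k => (ω k).re) atTop (𝓝 w)}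

end PolyExp

/-! The imaginary part of a zero only rotates the terms, by phases `exp (i q_j Im ω)`; compactness
of the torus carries these phases to a limit as `q → p`. Conversely, given phases `ξ` at `p`, there
are `q k → p` with `exp (i (k + 1) q_j) = ξ_j`. Shifting by `i (k + 1)` turns `Q(·, q k)` into the
`ξ`-rotated function, whose zero near `w` survives the perturbation
(`eventually_exists_zero_of_continuous`).

For (2), phases exist iff no modulus exceeds the sum of the others. These conditions are closed and
fail near `±∞`, where one term dominates, so `Λ(p)` is compact. Divided by its own term, each
condition bounds a convex function below, so it persists on one side of any point where it holds.
With three nonzero terms at most one condition is tight at a time, so no component is a single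
point. -/

theorem PolyExp.isOpen_S (n : ℕ) : IsOpen (PolyExp.S n) := by
  have h : PolyExp.S n = (⋂ i, {l | 0 < l i}) ∩
      ⋂ i, ⋂ _ : i ≠ Fin.last n, {l : Fin (n + 1) → ℝ | l i < l (Fin.last n)} := by
    ext l
    simp [PolyExp.S]
  rw [h]
  refine (isOpen_iInter_of_finite fun i => isOpen_lt continuous_const (continuous_apply i)).inter
    (isOpen_iInter_of_finite fun i => isOpen_iInter_of_finite fun _ =>
      isOpen_lt (continuous_apply i) (continuous_apply _))

theorem PolyExp.mem_Lam_of_forall_pos {n : ℕ} {a₀ : ℝ} {a p : Fin (n + 1) → ℝ} {w : ℝ}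
    (h : ∀ ε > 0, ∃ q ∈ PolyExp.S n, ∃ ω ∈ PolyExp.spectrum a₀ a q,
      dist q p < ε ∧ dist ω.re w < ε) : w ∈ PolyExp.Lam a₀ a p := by
  choose q hq ω hω hqp hωw using fun k : ℕ => h (1 / ((k : ℝ) + 1)) Nat.one_div_pos_of_nat
  refine ⟨q, ω, hq, hω, ?_, ?_⟩
  · exact tendsto_iff_dist_tendsto_zero.2 (squeeze_zero (fun _ => dist_nonneg)
      (fun k => (hqp k).le) tendsto_one_div_add_atTop_nhds_zero_nat)
  · exact tendsto_iff_dist_tendsto_zero.2 (squeeze_zero (fun _ => dist_nonneg)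
      (fun k => (hωw k).le) tendsto_one_div_add_atTop_nhds_zero_nat)

/-- Zeros of a holomorphic function that is not locally zero persist under perturbation. -/
theorem eventually_exists_zero_of_continuous {X : Type*} [TopologicalSpace X] {F : ℂ → X → ℂ}
    (hF : Continuous fun x : ℂ × X => F x.1 x.2) (hd : ∀ q, Differentiable ℂ fun z => F z q)
    {p : X} {w : ℂ} (hw : F w p = 0) (hne : ∃ z, F z p ≠ 0) {ε : ℝ} (hε : 0 < ε) :
    ∀ᶠ q in 𝓝 p, ∃ z, dist z w < ε ∧ F z q = 0 := by
  have hiso : ∀ᶠ z in 𝓝[≠] w, F z p ≠ 0 := by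
    have han : AnalyticOnNhd ℂ (fun z => F z p) Set.univ := fun z _ => (hd p).analyticAt z
    refine (han w trivial).eventually_eq_zero_or_eventually_ne_zero.resolve_left fun h0 => ?_
    obtain ⟨z, hz⟩ := hne
    exact hz (han.eqOn_zero_of_preconnected_of_eventuallyEq_zero isPreconnected_univ
      (Set.mem_univ w) h0 (Set.mem_univ z))
  obtain ⟨r₀, hr₀, hball⟩ := Metric.eventually_nhds_iff.1 (eventually_nhdsWithin_iff.1 hiso)
  set r := min (r₀ / 2) (ε / 2)
  have hrpos : 0 < r := by positivity
  have hrr₀ : r < r₀ := (min_le_left _ _).trans_lt (by linarith)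
  have hrε : r < ε := (min_le_right _ _).trans_lt (by linarith)
  have hsne : (Metric.sphere w r).Nonempty := NormedSpace.sphere_nonempty.2 hrpos.le
  obtain ⟨z₀, hz₀, hmin⟩ := (isCompact_sphere w r).exists_isMinOn hsne
    (f := fun z => ‖F z p‖) (hd p).continuous.norm.continuousOn
  set δ := ‖F z₀ p‖
  have hne' : ∀ z ∈ Metric.sphere w r, z ≠ w := by
    rintro z hz rfl
    simp at hz
    exact hrpos.ne hz
  have hδpos : 0 < δ := norm_pos_iff.2 (hball (by rw [Metric.mem_sphere.1 hz₀]; exact hrr₀)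
    (hne' z₀ hz₀))
  have h1 : ∀ᶠ q in 𝓝 p, ∀ z ∈ Metric.sphere w r, δ / 2 < ‖F z q - F w q‖ := by
    refine (isCompact_sphere w r).eventually_forall_of_forall_eventually fun z hz => ?_
    have hc : Continuous fun x : X × ℂ => ‖F x.2 x.1 - F w x.1‖ :=
      ((hF.comp continuous_swap).sub
        (hF.comp (continuous_const.prodMk continuous_fst))).norm
    refine hc.continuousAt.eventually (lt_mem_nhds ?_)
    have : δ ≤ ‖F z p‖ := hmin hz
    simp only [hw, sub_zero]
    linarith
  have h2 : ∀ᶠ q in 𝓝 p, ‖F w q‖ < δ / 4 := by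
    have hc : Continuous fun q => ‖F w q‖ :=
      (hF.comp (continuous_const.prodMk continuous_id)).norm
    refine hc.continuousAt.eventually (gt_mem_nhds ?_)
    simpa [hw] using hδpos
  filter_upwards [h1, h2] with q hq1 hq2
  -- Quantitative open mapping: the image of the closed ball contains the ball of radius `(δ / 2) /
  -- 2` about `F w q`, hence `0`.
  have hsub := ((hd q).diffContOnCl (s := Metric.ball w r)).ball_subset_image_closedBall hrpos
    (ε := δ / 2) (fun z hz => (hq1 z hz).le) (fun hloc => ?_)
  · obtain ⟨z, hz, hz0⟩ := hsub (show (0 : ℂ) ∈ _ by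
      rw [Metric.mem_ball, dist_zero_left]; linarith)
    exact ⟨z, (Metric.mem_closedBall.1 hz).trans_lt hrε, hz0⟩
  · have hconst := (hd q).differentiableOn.analyticOnNhd isOpen_univ |>.eq_of_eventuallyEq
      (g := fun _ => F w q) analyticOnNhd_const (hloc.mono fun _ h => not_not.1 h)
    have hlt := hq1 z₀ hz₀
    rw [congrFun hconst z₀, sub_self, norm_zero] at hlt
    linarith

/-- A torus point is attained as `exp (i q k)` for large `k` and `q` close to any given `p`. -/
theorem exists_tendsto_exp_eq {ι : Type*} (p : ι → ℝ) (ξ : ι → Circle) :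
    ∃ q : ℕ → ι → ℝ, Tendsto q atTop (𝓝 p) ∧
      ∀ k i, Complex.exp (q k i * (((k + 1 : ℕ) : ℂ) * Complex.I)) = ξ i := by
  choose θ hθ using fun i => Circle.surjOn_exp_neg_pi_pi (Set.mem_univ (ξ i))
  -- `2πN` lies within `2π` of `p i * (k + 1)`, so adding the bounded angle `θ i` and dividing by `k
  -- + 1` gives an error `O(1 / (k + 1))`.
  set N : ℕ → ι → ℤ := fun k i => ⌊p i * (k + 1 : ℕ) / (2 * Real.pi)⌋
  have hpi := Real.pi_pos
  refine ⟨fun k i => (θ i + N k i * (2 * Real.pi)) / (k + 1 : ℕ), ?_, fun k i => ?_⟩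
  · refine tendsto_pi_nhds.2 fun i => tendsto_iff_dist_tendsto_zero.2 ?_
    refine squeeze_zero (fun _ => dist_nonneg)
      (g := fun k : ℕ => (|θ i| + 2 * Real.pi) * (1 / ((k : ℝ) + 1))) (fun k => ?_) ?_
    · have hk : (0 : ℝ) < (k + 1 : ℕ) := by positivity
      have h1 := Int.floor_le (p i * (k + 1 : ℕ) / (2 * Real.pi))
      have h2 := Int.lt_floor_add_one (p i * (k + 1 : ℕ) / (2 * Real.pi))
      rw [le_div_iff₀ (by positivity)] at h1
      rw [div_lt_iff₀ (by positivity)] at h2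
      have h3 := abs_le.1 (le_refl |θ i|)
      rw [Real.dist_eq, div_sub' hk.ne', abs_div, abs_of_pos hk, mul_one_div, ← Nat.cast_succ]
      refine div_le_div_of_nonneg_right (abs_le.2 ⟨?_, ?_⟩) hk.le
      · simp only [N]; linarith
      · simp only [N]; linarith
    · simpa using tendsto_one_div_add_atTop_nhds_zero_nat.const_mul (|θ i| + 2 * Real.pi)
  · have hk : ((k + 1 : ℕ) : ℂ) ≠ 0 := by exact_mod_cast k.succ_ne_zero
    rw [← (hθ i).2, Circle.coe_exp]
    refine Complex.exp_eq_exp_iff_exists_int.2 ⟨N k i, ?_⟩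
    push_cast at hk ⊢
    field_simp

/-- Along the reals towards `-∞` only `a₀` survives. This is the nondegeneracy needed for zeros to
persist. -/
theorem PolyExp.exists_add_sum_exp_ne_zero {ι : Type*} [Fintype ι] {a₀ : ℂ} (h₀ : a₀ ≠ 0)
    (c : ι → ℂ) {p : ι → ℝ} (hp : ∀ i, 0 < p i) :
    ∃ z : ℂ, a₀ + ∑ i, c i * Complex.exp (p i * z) ≠ 0 := by
  have h : Tendsto (fun t : ℝ => a₀ + ∑ i, c i * Complex.exp (p i * (t : ℂ))) atBot
      (𝓝 (a₀ + ∑ i, c i * 0)) := by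
    refine tendsto_const_nhds.add (tendsto_finsetSum _ fun i _ => tendsto_const_nhds.mul ?_)
    refine tendsto_zero_iff_norm_tendsto_zero.2 ?_
    simp_rw [← Complex.ofReal_mul, Complex.norm_exp_ofReal]
    exact Real.tendsto_exp_atBot.comp (tendsto_id.const_mul_atBot (hp i))
  obtain ⟨t, ht⟩ := (h.eventually_ne (by simpa using h₀)).exists
  exact ⟨t, ht⟩

theorem PolyExp.Lam_eq {n : ℕ} {a₀ : ℝ} {a p : Fin (n + 1) → ℝ} (ha₀ : a₀ ≠ 0)
    (hp : p ∈ PolyExp.S n) :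
    PolyExp.Lam a₀ a p =
      {w : ℝ | ∃ ξ : Fin (n + 1) → Circle,
        (a₀ : ℂ) + ∑ i, (a i : ℂ) * (ξ i : ℂ) * Complex.exp ((p i : ℂ) * (w : ℂ)) = 0} := by
  ext w
  constructor
  · rintro ⟨q, ω, -, hω, hqp, hωw⟩
    obtain ⟨ξ, φ, hφ, hξ⟩ := CompactSpace.tendsto_subseq
      fun k => fun i => Circle.exp (q k i * (ω k).im)
    refine ⟨ξ, tendsto_nhds_unique (f := fun k => (a₀ : ℂ) + ∑ i, (a i : ℂ) *
      (Circle.exp (q (φ k) i * (ω (φ k)).im) : ℂ) *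
        Complex.exp ((q (φ k) i : ℂ) * ((ω (φ k)).re : ℂ))) (l := atTop) ?_ ?_⟩
    · refine tendsto_const_nhds.add (tendsto_finsetSum _ fun i _ => ?_)
      refine (tendsto_const_nhds.mul ?_).mul ?_
      · exact ((continuous_subtype_val (p := (· ∈ Submonoid.unitSphere ℂ))).tendsto _).comp (tendsto_pi_nhds.1 hξ i)
      · refine (Complex.continuous_exp.tendsto _).comp (Tendsto.mul ?_ ?_)
        · exact (Complex.continuous_ofReal.tendsto _).comp
            ((tendsto_pi_nhds.1 hqp i).comp hφ.tendsto_atTop)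
        · exact (Complex.continuous_ofReal.tendsto _).comp (hωw.comp hφ.tendsto_atTop)
    · refine tendsto_const_nhds.congr fun k => ?_
      rw [← show PolyExp.Q a₀ a (ω (φ k)) (q (φ k)) = 0 from hω (φ k), PolyExp.Q]
      congr 1
      refine Finset.sum_congr rfl fun i _ => ?_
      rw [mul_assoc, Circle.coe_exp, ← Complex.exp_add]
      congr 2
      conv_lhs => rw [← Complex.re_add_im (ω (φ k))]
      push_cast
      ring
  · rintro ⟨ξ, hξ⟩
    refine PolyExp.mem_Lam_of_forall_pos fun ε hε => ?_
    obtain ⟨q, hqp, hq⟩ := exists_tendsto_exp_eq p ξ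
    have hz := eventually_exists_zero_of_continuous (p := p) (w := w) (ε := ε)
      (F := fun z (l : Fin (n + 1) → ℝ) =>
        (a₀ : ℂ) + ∑ i, (a i : ℂ) * (ξ i : ℂ) * Complex.exp ((l i : ℂ) * z))
      (by fun_prop) (fun q => by fun_prop) hξ
      (PolyExp.exists_add_sum_exp_ne_zero (by exact_mod_cast ha₀) _ hp.1) hε
    obtain ⟨k, ⟨z, hzw, hz0⟩, hS, hd⟩ := ((hqp.eventually hz).and
      ((hqp.eventually ((PolyExp.isOpen_S n).mem_nhds hp)).and
        (hqp.eventually (Metric.ball_mem_nhds p hε)))).exists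
    refine ⟨q k, hS, z + ((k + 1 : ℕ) : ℂ) * Complex.I, ?_, hd, ?_⟩
    · rw [PolyExp.spectrum, Set.mem_ofPred_eq, ← hz0, PolyExp.Q]
      congr 1
      refine Finset.sum_congr rfl fun i _ => ?_
      rw [mul_add, Complex.exp_add, hq]
      ring
    · have : (z + ((k + 1 : ℕ) : ℂ) * Complex.I).re = z.re := by simp
      rw [this, Real.dist_eq]
      refine lt_of_le_of_lt ?_ hzw
      rw [dist_eq_norm]
      simpa using Complex.abs_re_le_norm (z - w)

/-! ### The polygon inequality -/

/-- Greedy choice: give each new term the sign opposite to the running sum. -/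
theorem exists_signs_abs_sum_le {ι : Type*} (b : ι → ℝ) (s : Finset ι) {M : ℝ} (hM : 0 ≤ M)
    (h : ∀ i ∈ s, |b i| ≤ M) :
    ∃ ε : ι → ℝ, (∀ i, ε i = 1 ∨ ε i = -1) ∧ |∑ i ∈ s, ε i * b i| ≤ M := by
  classical
  induction s using Finset.induction_on with
  | empty => exact ⟨fun _ => 1, fun _ => Or.inl rfl, by simpa using hM⟩
  | insert j s hj ih =>
    obtain ⟨ε, hε, hs⟩ := ih fun i hi => h i (Finset.mem_insert_of_mem hi)
    have hb := abs_le.1 (h j (Finset.mem_insert_self j s))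
    have key : ∃ e : ℝ, (e = 1 ∨ e = -1) ∧ |e * b j + ∑ i ∈ s, ε i * b i| ≤ M := by
      set t := ∑ i ∈ s, ε i * b i
      have ht := abs_le.1 hs
      rcases le_total 0 (b j) with h1 | h1 <;> rcases le_total 0 t with h2 | h2
      · exact ⟨-1, Or.inr rfl, abs_le.2 ⟨by linarith, by linarith⟩⟩
      · exact ⟨1, Or.inl rfl, abs_le.2 ⟨by linarith, by linarith⟩⟩
      · exact ⟨1, Or.inl rfl, abs_le.2 ⟨by linarith, by linarith⟩⟩
      · exact ⟨-1, Or.inr rfl, abs_le.2 ⟨by linarith, by linarith⟩⟩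
    obtain ⟨e, he, hle⟩ := key
    refine ⟨Function.update ε j e, fun i => ?_, ?_⟩
    · by_cases hi : i = j
      · subst hi; simpa using he
      · simpa [hi] using hε i
    · rw [Finset.sum_insert hj, Function.update_self]
      convert hle using 3
      refine Finset.sum_congr rfl fun i hi => ?_
      rw [Function.update_of_ne (ne_of_mem_of_not_mem hi hj)]

theorem exists_circle_of_signs {ι : Type*} {ε : ι → ℝ} (hε : ∀ i, ε i = 1 ∨ ε i = -1) :
    ∃ ξ : ι → Circle, ∀ i, (ξ i : ℂ) = (ε i : ℂ) := by
  refine ⟨fun i => ⟨(ε i : ℂ), mem_sphere_zero_iff_norm.2 ?_⟩, fun i => rfl⟩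
  rcases hε i with h | h <;> simp [h]

/-- The generalized polygon inequality: numbers of moduli `|b i|` can be rotated to have sum zero
if and only if no modulus exceeds the sum of the others. -/
theorem exists_circle_sum_eq_zero_iff {ι : Type*} [Fintype ι] (b : ι → ℝ) :
    (∃ ξ : ι → Circle, ∑ i, (b i : ℂ) * (ξ i : ℂ) = 0) ↔ ∀ j, 2 * |b j| ≤ ∑ i, |b i| := by
  classical
  constructor
  · rintro ⟨ξ, hξ⟩ j
    rw [← Finset.add_sum_erase _ _ (Finset.mem_univ j)] at hξ ⊢
    have : |b j| ≤ ∑ i ∈ Finset.univ.erase j, |b i| := by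
      calc |b j| = ‖(b j : ℂ) * (ξ j : ℂ)‖ := by simp [Circle.norm_coe]
        _ = ‖∑ i ∈ Finset.univ.erase j, (b i : ℂ) * (ξ i : ℂ)‖ := by
          rw [eq_neg_of_add_eq_zero_left hξ, norm_neg]
        _ ≤ ∑ i ∈ Finset.univ.erase j, ‖(b i : ℂ) * (ξ i : ℂ)‖ := norm_sum_le _ _
        _ = ∑ i ∈ Finset.univ.erase j, |b i| :=
          Finset.sum_congr rfl fun i _ => by simp [Circle.norm_coe]
    linarith
  · intro h
    rcases isEmpty_or_nonempty ι with hι | hι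
    · exact ⟨fun _ => 1, by simp⟩
    obtain ⟨j, hj⟩ := Finite.exists_max fun i => |b i|
    by_cases hbj : b j = 0
    · refine ⟨fun _ => 1, Finset.sum_eq_zero fun i _ => ?_⟩
      have : b i = 0 := abs_nonpos_iff.1 (by simpa [hbj] using hj i)
      simp [this]
    let f : (ι → Circle) → ℝ := fun ξ => ‖∑ i ∈ Finset.univ.erase j, (b i : ℂ) * (ξ i : ℂ)‖
    have hf : Continuous f := by fun_prop
    -- Intermediate values on the connected torus, with `j` of largest modulus: greedy signs bring
    -- `f` to at most `|b j|`, aligned terms to at least `|b j|`.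
    obtain ⟨ξ, hξ⟩ : |b j| ∈ Set.range f := by
      refine mem_range_of_exists_le_of_exists_ge hf ?_ ?_
      · obtain ⟨ε, hε, hle⟩ := exists_signs_abs_sum_le b (Finset.univ.erase j) (abs_nonneg (b j))
          fun i _ => hj i
        obtain ⟨ξ, hξ⟩ := exists_circle_of_signs hε
        refine ⟨ξ, ?_⟩
        simp only [f, hξ]
        rw [← Real.norm_eq_abs, ← Complex.norm_real] at hle
        push_cast at hle
        simpa [mul_comm] using hle
      · obtain ⟨ξ, hξ⟩ := exists_circle_of_signs (ε := fun i => if 0 ≤ b i then 1 else -1)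
          fun i => by split_ifs <;> simp
        refine ⟨ξ, ?_⟩
        have hs : ∑ i ∈ Finset.univ.erase j, (b i : ℂ) * (ξ i : ℂ) =
            ((∑ i ∈ Finset.univ.erase j, |b i| : ℝ) : ℂ) := by
          push_cast
          refine Finset.sum_congr rfl fun i _ => ?_
          rw [hξ, ← Complex.ofReal_mul]
          congr 1
          split_ifs with h0
          · rw [mul_one, abs_of_nonneg h0]
          · rw [abs_of_neg (not_le.1 h0)]; ring
        have hj' := h j
        rw [← Finset.add_sum_erase _ _ (Finset.mem_univ j)] at hj'
        simp only [f]
        rw [hs, Complex.norm_real, Real.norm_eq_abs]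
        exact le_trans (by linarith) (le_abs_self _)
    have hbj' : (b j : ℂ) ≠ 0 := by exact_mod_cast hbj
    set t := ∑ i ∈ Finset.univ.erase j, (b i : ℂ) * (ξ i : ℂ)
    have hnorm : ‖-t / (b j : ℂ)‖ = 1 := by
      have : ‖t‖ = |b j| := hξ
      rw [norm_div, norm_neg, this, Complex.norm_real, Real.norm_eq_abs,
        div_self (abs_ne_zero.2 hbj)]
    obtain ⟨u, hu⟩ : ∃ u : Circle, (u : ℂ) = -t / (b j : ℂ) :=
      ⟨⟨_, mem_sphere_zero_iff_norm.2 hnorm⟩, rfl⟩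
    refine ⟨Function.update ξ j u, ?_⟩
    rw [← Finset.add_sum_erase _ _ (Finset.mem_univ j), Function.update_self]
    have : ∑ i ∈ Finset.univ.erase j, (b i : ℂ) *
        (Function.update ξ j u i : ℂ) = t := by
      refine Finset.sum_congr rfl fun i hi => ?_
      rw [Function.update_of_ne (Finset.ne_of_mem_erase hi)]
    rw [this, hu, mul_div_cancel₀ _ hbj', neg_add_cancel]

/-- The set where the terms `c i * exp (P i * w)` satisfy the polygon inequalities. -/
def polygonSet {ι : Type*} [Fintype ι] (c P : ι → ℝ) : Set ℝ :=
  {w | ∀ j, 2 * |c j * Real.exp (P j * w)| ≤ ∑ i, |c i * Real.exp (P i * w)|}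

theorem PolyExp.exists_circle_iff_mem_polygonSet {n : ℕ} (a₀ : ℝ) (a p : Fin (n + 1) → ℝ) (w : ℝ) :
    (∃ ξ : Fin (n + 1) → Circle,
      (a₀ : ℂ) + ∑ i, (a i : ℂ) * (ξ i : ℂ) * Complex.exp ((p i : ℂ) * (w : ℂ)) = 0) ↔
    w ∈ polygonSet (fun i : Option (Fin (n + 1)) => i.elim a₀ a) (fun i => i.elim 0 p) := by
  rw [polygonSet, Set.mem_ofPred_eq, ← exists_circle_sum_eq_zero_iff]
  simp only [Fintype.sum_option, Option.elim_none, Option.elim_some, zero_mul, Real.exp_zero,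
    mul_one]
  constructor
  · rintro ⟨ξ, h⟩
    refine ⟨fun i => i.elim 1 ξ, ?_⟩
    rw [← h]
    simp only [Option.elim_none, Option.elim_some, Circle.coe_one, mul_one]
    congr 1
    refine Finset.sum_congr rfl fun i _ => ?_
    push_cast
    ring
  · rintro ⟨ξ, h⟩
    -- A common rotation makes the phase of the constant term `1`.
    refine ⟨fun i => ξ (some i) / ξ none, ?_⟩
    have h0 := (ξ none).coe_ne_zero
    rw [← mul_right_inj' h0, mul_zero, ← h, mul_add, Finset.mul_sum]
    congr 1
    · ring
    refine Finset.sum_congr rfl fun i _ => ?_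
    push_cast
    field_simp

/-! ### Geometry of the polygon set on the line -/

section PolygonSet

variable {ι : Type*} [Fintype ι] {c P : ι → ℝ}

theorem isClosed_polygonSet : IsClosed (polygonSet c P) := by
  simp only [polygonSet, Set.ofPred_forall]
  exact isClosed_iInter fun j => isClosed_le (by fun_prop) (by fun_prop)

theorem polygonSet_inequality_iff (j : ι) (w : ℝ) :
    2 * |c j * Real.exp (P j * w)| ≤ ∑ i, |c i * Real.exp (P i * w)| ↔
      2 * |c j| ≤ ∑ i, |c i| * Real.exp ((P i - P j) * w) := by
  have he := Real.exp_pos (P j * w)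
  have h : ∑ i, |c i * Real.exp (P i * w)| =
      (∑ i, |c i| * Real.exp ((P i - P j) * w)) * Real.exp (P j * w) := by
    rw [Finset.sum_mul]
    refine Finset.sum_congr rfl fun i _ => ?_
    rw [abs_mul, Real.abs_exp, mul_assoc, ← Real.exp_add]
    ring_nf
  rw [h, abs_mul, Real.abs_exp, ← mul_assoc, mul_le_mul_iff_left₀ he]

theorem polygonSet_neg : polygonSet c (-P) = -polygonSet c P := by
  ext w
  simp [polygonSet]

/-- After division by the dominant exponential, the right side of condition `j` tends to `|c j| < 2
* |c j|`. -/
theorem bddAbove_polygonSet {j : ι} (hc : c j ≠ 0) (hP : ∀ i ≠ j, P i < P j) :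
    BddAbove (polygonSet c P) := by
  classical
  have h : Tendsto (fun w : ℝ => ∑ i, |c i| * Real.exp ((P i - P j) * w)) atTop
      (𝓝 (∑ i, if i = j then |c j| else 0)) := by
    refine tendsto_finsetSum _ fun i _ => ?_
    split_ifs with hij
    · subst hij
      simp
    · rw [← mul_zero |c i|]
      exact (Real.tendsto_exp_atBot.comp
        (tendsto_id.const_mul_atTop_of_neg (sub_neg.2 (hP i hij)))).const_mul _
  rw [Finset.sum_ite_eq' Finset.univ j, if_pos (Finset.mem_univ j)] at h
  obtain ⟨B, hB⟩ := eventually_atTop.1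
    (h.eventually (gt_mem_nhds (show |c j| < 2 * |c j| by linarith [abs_pos.2 hc])))
  refine ⟨B, fun w hw => le_of_not_gt fun hlt => ?_⟩
  exact absurd ((polygonSet_inequality_iff j w).1 (hw j)) (not_le.2 (hB w hlt.le))

theorem bddBelow_polygonSet {j : ι} (hc : c j ≠ 0) (hP : ∀ i ≠ j, P j < P i) :
    BddBelow (polygonSet c P) := by
  rw [← bddAbove_neg, ← polygonSet_neg]
  exact bddAbove_polygonSet hc fun i hi => neg_lt_neg (hP i hi)

theorem convexOn_sum_exp (c P : ι → ℝ) (j : ι) :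
    ConvexOn ℝ Set.univ fun w : ℝ => ∑ i, |c i| * Real.exp ((P i - P j) * w) := by
  have hterm : ∀ i, ConvexOn ℝ Set.univ fun w : ℝ => |c i| * Real.exp ((P i - P j) * w) := fun i =>
    ConvexOn.smul (abs_nonneg (c i))
      (show ConvexOn ℝ Set.univ (Real.exp ∘ ((P i - P j) • LinearMap.id : ℝ →ₗ[ℝ] ℝ)) by
        exact convexOn_exp.comp_linearMap ((P i - P j) • LinearMap.id : ℝ →ₗ[ℝ] ℝ))
  refine Finset.sum_induction (p := fun f : ℝ → ℝ => ConvexOn ℝ Set.univ f)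
    (fun i w => |c i| * Real.exp ((P i - P j) * w)) (fun _ _ => ConvexOn.add)
    (convexOn_const 0 convex_univ) (s := Finset.univ) (fun i _ => hterm i) |>.congr fun w _ => ?_
  simp

/-- The set `{f < r}` is an interval missing `w`, so it lies on one side of `w`. -/
theorem ConvexOn.forall_ge_or_forall_le_of_le {f : ℝ → ℝ} (hf : ConvexOn ℝ Set.univ f) {w r : ℝ}
    (hw : r ≤ f w) : (∀ x, w ≤ x → r ≤ f x) ∨ ∀ x, x ≤ w → r ≤ f x := by
  by_contra! h
  obtain ⟨⟨x, hx, hfx⟩, y, hy, hfy⟩ := h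
  have := hf.convex_lt r
  have hmem := this.ordConnected.out ⟨Set.mem_univ y, hfy⟩ ⟨Set.mem_univ x, hfx⟩ ⟨hy, hx⟩
  exact absurd hmem.2 (not_lt.2 hw)

/-- Term `j` is half of the total, and a third nonzero term leaves less than half for `k`. -/
theorem polygonSet_strict_of_tight {w : ℝ} {j k : ι} (hjk : j ≠ k)
    (h3 : ∃ i, i ≠ j ∧ i ≠ k ∧ c i ≠ 0)
    (hj : 2 * |c j * Real.exp (P j * w)| = ∑ i, |c i * Real.exp (P i * w)|) :
    2 * |c k * Real.exp (P k * w)| < ∑ i, |c i * Real.exp (P i * w)| := by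
  classical
  obtain ⟨i, hij, hik, hci⟩ := h3
  have hpos : 0 < |c i * Real.exp (P i * w)| := by positivity
  have hsub : ∑ l ∈ {i, j, k}, |c l * Real.exp (P l * w)| ≤ ∑ l, |c l * Real.exp (P l * w)| :=
    Finset.sum_le_sum_of_subset_of_nonneg (Finset.subset_univ _) fun _ _ _ => abs_nonneg _
  rw [Finset.sum_insert (by simp [hij, hik]), Finset.sum_pair hjk] at hsub
  linarith

theorem exists_Icc_subset_polygonSet (h3 : ∀ j k : ι, ∃ i, i ≠ j ∧ i ≠ k ∧ c i ≠ 0) {w : ℝ}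
    (hw : w ∈ polygonSet c P) :
    ∃ x y, x < y ∧ w ∈ Set.Icc x y ∧ Set.Icc x y ⊆ polygonSet c P := by
  have hstrict : ∀ {k : ι},
      2 * |c k * Real.exp (P k * w)| < ∑ i, |c i * Real.exp (P i * w)| →
      ∀ᶠ x in 𝓝 w, 2 * |c k * Real.exp (P k * x)| ≤ ∑ i, |c i * Real.exp (P i * x)| := fun hk =>
    ((ContinuousAt.eventually_lt (by fun_prop) (by fun_prop) hk)).mono fun _ => le_of_lt
  by_cases htight : ∃ j, 2 * |c j * Real.exp (P j * w)| = ∑ i, |c i * Real.exp (P i * w)|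
  · obtain ⟨j, hj⟩ := htight
    have hev : ∀ᶠ x in 𝓝 w, ∀ k, k ≠ j →
        2 * |c k * Real.exp (P k * x)| ≤ ∑ i, |c i * Real.exp (P i * x)| := by
      refine eventually_all.2 fun k => ?_
      by_cases hkj : k = j
      · exact Eventually.of_forall fun _ h => absurd hkj h
      · exact (hstrict (polygonSet_strict_of_tight (Ne.symm hkj) (h3 j k) hj)).mono
          fun _ h _ => h
    obtain ⟨r, hr, hball⟩ := Metric.eventually_nhds_iff.1 hev
    have key : ∀ x, dist x w < r → 2 * |c j| ≤ ∑ i, |c i| * Real.exp ((P i - P j) * x) →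
        x ∈ polygonSet c P := by
      intro x hx hxj k
      by_cases hkj : k = j
      · subst hkj
        exact (polygonSet_inequality_iff k x).2 hxj
      · exact hball hx k hkj
    rcases (convexOn_sum_exp c P j).forall_ge_or_forall_le_of_le
      ((polygonSet_inequality_iff j w).1 (hw j)) with h | h
    · refine ⟨w, w + r / 2, by linarith, ⟨le_rfl, by linarith⟩, fun x hx => key x ?_ (h x hx.1)⟩
      rw [Real.dist_eq, abs_of_nonneg (by linarith [hx.1])]
      linarith [hx.2]
    · refine ⟨w - r / 2, w, by linarith, ⟨by linarith, le_rfl⟩, fun x hx => key x ?_ (h x hx.2)⟩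
      rw [Real.dist_eq, abs_of_nonpos (by linarith [hx.2])]
      linarith [hx.1]
  · push Not at htight
    obtain ⟨r, hr, hball⟩ := Metric.eventually_nhds_iff.1
      (eventually_all.2 fun k => hstrict (lt_of_le_of_ne (hw k) (htight k)))
    refine ⟨w - r / 2, w + r / 2, by linarith, ⟨by linarith, by linarith⟩, fun x hx => hball ?_⟩
    rw [Real.dist_eq]
    exact (abs_le.2 ⟨by linarith [hx.1], by linarith [hx.2]⟩ : |x - w| ≤ r / 2).trans_lt
      (by linarith)

end PolygonSet

/-- A compact subset of the line all of whose components are nondegenerate is a countable disjoint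
union of nondegenerate closed intervals. -/
theorem IsCompact.exists_countable_disjoint_Icc {K : Set ℝ} (hK : IsCompact K)
    (h : ∀ w ∈ K, ∃ x y, x < y ∧ w ∈ Set.Icc x y ∧ Set.Icc x y ⊆ K) :
    ∃ C : Set (ℝ × ℝ), C.Countable ∧ (∀ I ∈ C, I.1 < I.2) ∧
      C.PairwiseDisjoint (fun I => Set.Icc I.1 I.2) ∧ K = ⋃ I ∈ C, Set.Icc I.1 I.2 := by
  let e : ℝ → ℝ × ℝ := fun w => (sInf (connectedComponentIn K w), sSup (connectedComponentIn K w))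
  have he : ∀ w ∈ K, connectedComponentIn K w = Set.Icc (e w).1 (e w).2 := by
    intro w hw
    refine eq_Icc_of_connected_compact
      ⟨⟨w, mem_connectedComponentIn hw⟩, isPreconnected_connectedComponentIn⟩ ?_
    refine hK.of_isClosed_subset ?_ (connectedComponentIn_subset K w)
    refine isClosed_of_closure_subset
      (isPreconnected_connectedComponentIn.closure.subset_connectedComponentIn
        (subset_closure (mem_connectedComponentIn hw)) ?_)
    exact closure_minimal (connectedComponentIn_subset K w) hK.isClosed
  have hlt : ∀ I ∈ e '' K, I.1 < I.2 := by
    rintro _ ⟨w, hw, rfl⟩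
    obtain ⟨x, y, hxy, hwm, hsub⟩ := h w hw
    have hcc := isPreconnected_Icc.subset_connectedComponentIn hwm hsub
    rw [he w hw, Set.Icc_subset_Icc_iff hxy.le] at hcc
    linarith [hcc.1, hcc.2]
  have hdisj : (e '' K).PairwiseDisjoint (fun I => Set.Icc I.1 I.2) := by
    rintro _ ⟨v, hv, rfl⟩ _ ⟨w, hw, rfl⟩ hne
    refine Set.disjoint_left.2 fun x hxv hxw => hne ?_
    beta_reduce at hxv hxw
    rw [← he v hv] at hxv
    rw [← he w hw] at hxw
    simp only [e]
    rw [connectedComponentIn_eq hxv, connectedComponentIn_eq hxw]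
  refine ⟨e '' K, hdisj.countable_of_nonempty_interior fun I hI => ?_, hlt, hdisj, ?_⟩
  · rw [interior_Icc]
    exact Set.nonempty_Ioo.2 (hlt I hI)
  · refine Set.Subset.antisymm (fun w hw => ?_) (Set.iUnion₂_subset ?_)
    · refine Set.mem_biUnion (Set.mem_image_of_mem e hw) ?_
      rw [← he w hw]
      exact mem_connectedComponentIn hw
    · rintro _ ⟨w, hw, rfl⟩
      rw [← he w hw]
      exact connectedComponentIn_subset K w

theorem proposition3p2p1 (n : ℕ) (a₀ : ℝ) (a : Fin (n + 1) → ℝ) (ha₀ : a₀ ≠ 0)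
    (p : Fin (n + 1) → ℝ) (hp : p ∈ PolyExp.S n) :
    PolyExp.Lam a₀ a p =
      {w : ℝ | ∃ ξ : Fin (n + 1) → Circle,
        (a₀ : ℂ) + ∑ i, (a i : ℂ) * (ξ i : ℂ) * Complex.exp ((p i : ℂ) * (w : ℂ)) = 0} ∧
    (a (Fin.last n) ≠ 0 → (∃ j, j ≠ Fin.last n ∧ a j ≠ 0) →
      ∃ C : Set (ℝ × ℝ), C.Countable ∧ (∀ I ∈ C, I.1 < I.2) ∧
        C.PairwiseDisjoint (fun I => Set.Icc I.1 I.2) ∧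
        PolyExp.Lam a₀ a p = ⋃ I ∈ C, Set.Icc I.1 I.2) := by
  refine ⟨PolyExp.Lam_eq ha₀ hp, fun hlast ⟨j, hj, haj⟩ => ?_⟩
  have hL : PolyExp.Lam a₀ a p =
      polygonSet (fun i : Option (Fin (n + 1)) => i.elim a₀ a) (fun i => i.elim 0 p) := by
    rw [PolyExp.Lam_eq ha₀ hp]
    exact Set.ext fun w => PolyExp.exists_circle_iff_mem_polygonSet a₀ a p w
  rw [hL]
  refine IsCompact.exists_countable_disjoint_Icc (Metric.isCompact_of_isClosed_isBounded
    isClosed_polygonSet (isBounded_iff_bddBelow_bddAbove.2 ⟨?_, ?_⟩))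
    fun w hw => exists_Icc_subset_polygonSet (fun k l => ?_) hw
  · refine bddBelow_polygonSet (j := none) ha₀ fun i hi => ?_
    obtain ⟨i, rfl⟩ := Option.ne_none_iff_exists'.1 hi
    exact hp.1 i
  · refine bddAbove_polygonSet (j := some (Fin.last n)) hlast fun i hi => ?_
    cases i with
    | none => exact hp.1 _
    | some i => exact hp.2 i fun h => hi (congrArg some h)
  · have hjl : (some j : Option (Fin (n + 1))) ≠ some (Fin.last n) := fun h =>
      hj (Option.some_injective _ h)
    -- Of the three nonzero terms `none`, `some j` and the last, `k` and `l` exclude at most two.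
    by_cases h1 : none ≠ k ∧ none ≠ l
    · exact ⟨none, h1.1, h1.2, ha₀⟩
    by_cases h2 : some j ≠ k ∧ some j ≠ l
    · exact ⟨some j, h2.1, h2.2, haj⟩
    · refine ⟨some (Fin.last n), ?_, ?_, hlast⟩ <;> grind
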